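/- **Setting.** A point cloud with $n\ge 1$ points is $P=(p_1,\dots,p_n)\in\mathbb R^{n\times 3}$, with $d_{ij}=\|p_i-p_j\|$. Two point clouds are isomorphic if they have the same number of points and agree up to a permutation of the points, an orthogonal transformation of $\mathbb R^3$ and a translation. A function on point clouds of all finite sizes is E(3)-complete if it takes equal values on isomorphic point clouds and different values on non-isomorphic ones; it is E(3)-complete up to size $N$ if it takes equal values on isomorphic point clouds and different values on non-isomorphic ones with at most $N$ points each ($N=\infty$ gives E(3)-completeness). **Models.** Let $r_{\mathrm{sub}},r_{\mathrm{cutoff}}\in[0,\infty]$. The distance graph $G$ has vertex set $[n]$ and neighbourhoods $\mathcal N_G(v)=\{w: d_{wv}\le r_{\mathrm{cutoff}}\}$ (so $v\in\mathcal N_G(v)$); the ego subgraph $G^u$ is the subgraph of $G$ induced on $\{a: d_{au}\le r_{\mathrm{sub}}\}$, and $\mathcal N_{G^u}(v)$ is the set of neighbours of $v$ in it. Node marking: $h^{(0)}_{uv}=f^{\mathrm{init}}(\mathbb 1_{u=v})$ for all $u,v\in[n]$. For $l=0,\dots,L-1$, $h=h^{(l)}$ and $f=f^{(l)}$, let $$\mathrm{Loc}_{uv}=\{\!\!\{(h_{uw},d_{vw}):w\in\mathcal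 N_{G^u}(v)\}\!\!\},\quad \mathrm{Cr}_{v}=\{\!\!\{(h_{ww'},d_{w'v}):w\in[n],\,w'\in\mathcal N_G(v)\}\!\!\},$$ $$\mathrm{Row}_u=\{\!\!\{h_{uw}:w\in[n]\}\!\!\},\quad \mathrm{Col}_v=\{\!\!\{h_{wv}:w\in[n]\}\!\!\}.$$ The feature $h^{(l+1)}_{uv}$ is - GeoIDGNN, GeoDS-GNN, GeoOSAN: $f(h_{uv},\mathrm{Loc}_{uv})$, with VS or SV pooling; - GeoGNN-AK: $f(h_{uv},h_{vv},\mathrm{Loc}_{uv})$ if $u\ne v$, and $f(h_{vv},\mathrm{Loc}_{uv},\mathrm{Row}_u)$ if $u=v$; VS pooling; - GeoDSS-GNN: $f(h_{uv},\mathrm{Loc}_{uv},\mathrm{Col}_v,\mathrm{Cr}_v)$; VS pooling; - GeoGNN-AK-ctx: $f(h_{uv},h_{vv},\mathrm{Loc}_{uv})$ if $u\neq v$, and $f(h_{vv},\mathrm{Loc}_{uv},\mathrm{Row}_u,\mathrm{Col}_v)$ if $u=v$; VS pooling; - GeoSUN: $f(h_{uv},h_{uu},h_{vv},\mathrm{Loc}_{uv},\mathrm{Row}_u,\mathrm{Col}_v,\mathrm{Cr}_v)$,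 with VS or SV pooling. (For GeoGNN-AK and GeoGNN-AK-ctx, $f$ is one function on the disjoint union of its two kinds of arguments.) The output is $g_2(\{\!\!\{g_1(\{\!\!\{h^{(L)}_{uv}:v\in[n]\}\!\!\}):u\in[n]\}\!\!\})$ for VS pooling and $g_2(\{\!\!\{g_1(\{\!\!\{h^{(L)}_{uv}:u\in[n]\}\!\!\}):v\in[n]\}\!\!\})$ for SV pooling. **Theorem.** There is a constant $C$ such that for each of these seven architectures, each of its pooling schemes and each number of layers $L>C$, when $r_{\mathrm{sub}}=r_{\mathrm{cutoff}}=\infty$, the following hold. 1. Let $N\in\mathbb N\cup\{\infty\}$, and let the features of each layer, the intermediate pooled features and the outputs lie in arbitrary sets. If $f^{\mathrm{init}}$ is injective, each $f^{(l)}$ is injective on the arguments that can occur for point clouds with at most $N$ points (and arbitrary node features), and $g_1,g_2$ are injective on multisets with at most $N$ elements, then the function computed by the model is E(3)-complete up to size $N$. In particular (take $N=\infty$) it is E(3)-complete if all intermediate functions are injective. 2. For every $k\ge1$ there are intermediate functions with all features and outputs in $\mathbb R^k$ that satisfy the hypotheses of 1 with $N=\infty$, so that the model computes an E(3)-complete function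 with values in $\mathbb R^k$. -/

import Mathlib

open scoped ENNReal

universe u

namespace GeoSubgraph

/-- Three-dimensional Euclidean space. -/
abbrev Point : Type := EuclideanSpace ℝ (Fin 3)

/-- A point cloud with `n` (not necessarily distinct) points, an element of `ℝ^{n × 3}`. -/
abbrev PointCloud (n : ℕ) : Type := Fin n → Point

/-- Two point clouds are isomorphic if they agree up to a relabelling of the points, an orthogonal
transformation and a translation. (An `Equiv` between `Fin n` and `Fin m` forces `n = m`.) -/
def Isomorphic {n m : ℕ} (P : PointCloud n) (Q : PointCloud m) : Prop :=
  ∃ (σ : Fin n ≃ Fin m) (R : Point ≃ₗᵢ[ℝ] Point) (t : Point), ∀ i, Q (σ i) = R (P i) + t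

/-- A function on point clouds is permutation- and E(3)-invariant if it agrees on isomorphic
point clouds. -/
def IsInvariant {O : Type u} (f : ∀ n : ℕ, PointCloud n → O) : Prop :=
  ∀ (n m : ℕ) (P : PointCloud n) (Q : PointCloud m), Isomorphic P Q → f n P = f m Q

/-- `f` is invariant, and takes different values on any two non-isomorphic (nonempty) point clouds
with at most `N` points each. -/
structure E3CompleteUpTo {O : Type u} (N : ℕ∞) (f : ∀ n : ℕ, PointCloud n → O) : Prop where
  invariant : IsInvariant f
  separates : ∀ (n m : ℕ), 0 < n → 0 < m → (n : ℕ∞) ≤ N → (m : ℕ∞) ≤ N →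
    ∀ (P : PointCloud n) (Q : PointCloud m), ¬ Isomorphic P Q → f n P ≠ f m Q

/-- E(3)-completeness, on point clouds of all finite sizes. -/
def E3Complete {O : Type u} (f : ∀ n : ℕ, PointCloud n → O) : Prop :=
  E3CompleteUpTo ⊤ f

section Graph

variable {n : ℕ}

/-- Adjacency in the distance graph with interaction cutoff `rcut`
(a point is adjacent to itself). -/
def Edge (rcut : ℝ≥0∞) (P : PointCloud n) (a b : Fin n) : Prop :=
  edist (P a) (P b) ≤ rcut

/-- `a` is a vertex of the ego subgraph `G^u` of size `rsub` around `u`. -/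
def InEgo (rsub : ℝ≥0∞) (P : PointCloud n) (u a : Fin n) : Prop :=
  edist (P a) (P u) ≤ rsub

open Classical in
/-- The neighbours of `v` in the distance graph `G`. -/
noncomputable def nbr (rcut : ℝ≥0∞) (P : PointCloud n) (v : Fin n) : Finset (Fin n) :=
  Finset.univ.filter fun w => Edge rcut P w v

open Classical in
/-- The neighbours of `v` in the ego subgraph `G^u`, which has the edges of `G` both of whose
ends are vertices of `G^u`. -/
noncomputable def egoNbr (rsub rcut : ℝ≥0∞) (P : PointCloud n) (u v : Fin n) : Finset (Fin n) :=
  Finset.univ.filter fun w => InEgo rsub P u w ∧ InEgo rsub P u v ∧ Edge rcut P w v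

end Graph

section Operations

variable {n : ℕ} {H : Type u}

/-- `{{ h_{uw} : w ∈ V_G }}`. -/
def globalU (h : Fin n → Fin n → H) (u : Fin n) : Multiset H :=
  Finset.univ.val.map fun w => h u w

/-- `{{ h_{wv} : w ∈ V_G }}`. -/
def globalV (h : Fin n → Fin n → H) (v : Fin n) : Multiset H :=
  Finset.univ.val.map fun w => h w v

/-- The distance-aware local aggregation `{{ (h_{uw}, d_{vw}) : w ∈ N_{G^u}(v) }}`. -/
noncomputable def geoLocalU (rsub rcut : ℝ≥0∞) (P : PointCloud n) (h : Fin n → Fin n → H)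
    (u v : Fin n) : Multiset (H × ℝ) :=
  (egoNbr rsub rcut P u v).val.map fun w => (h u w, dist (P v) (P w))

/-- The distance-aware cross-subgraph aggregation
`{{ (h_{ww'}, d_{w'v}) : w ∈ V_G, w' ∈ N_G(v) }}`. -/
noncomputable def geoCross (rcut : ℝ≥0∞) (P : PointCloud n) (h : Fin n → Fin n → H)
    (v : Fin n) : Multiset (H × ℝ) :=
  ((Finset.univ : Finset (Fin n)) ×ˢ nbr rcut P v).val.map
    fun p => (h p.1 p.2, dist (P p.2) (P v))

end Operations

/-- The seven subgraph GNN architectures. -/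
inductive Arch where
  | GeoIDGNN
  | GeoDSGNN
  | GeoOSAN
  | GeoGNNAK
  | GeoDSSGNN
  | GeoGNNAKctx
  | GeoSUN

/-- Vertex-subgraph and subgraph-vertex pooling. -/
inductive Pooling where
  | VS
  | SV

/-- The pooling schemes that an architecture may use. -/
def Arch.AllowsPooling : Arch → Pooling → Prop
  | .GeoIDGNN, _ => True
  | .GeoDSGNN, _ => True
  | .GeoOSAN, _ => True
  | .GeoGNNAK, p => p = .VS
  | .GeoDSSGNN, p => p = .VS
  | .GeoGNNAKctx, p => p = .VS
  | .GeoSUN, _ => True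

/-- The domain of the layer function `f^{(l)}` of an architecture, for node features in `H`.
For `GeoGNNAK` and `GeoGNNAKctx` the layer function takes two kinds of arguments, those for
`u ≠ v` (left summand) and those for `u = v` (right summand). -/
def Arch.Input : Arch → Type u → Type u
  | .GeoIDGNN, H => H × Multiset (H × ℝ)
  | .GeoDSGNN, H => H × Multiset (H × ℝ)
  | .GeoOSAN, H => H × Multiset (H × ℝ)
  | .GeoGNNAK, H =>
      (H × H × Multiset (H × ℝ)) ⊕ (H × Multiset (H × ℝ) × Multiset H)
  | .GeoDSSGNN, H =>
      H × Multiset (H × ℝ) × Multiset H × Multiset (H × ℝ)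
  | .GeoGNNAKctx, H =>
      (H × H × Multiset (H × ℝ)) ⊕ (H × Multiset (H × ℝ) × Multiset H × Multiset H)
  | .GeoSUN, H =>
      H × H × H × Multiset (H × ℝ) × Multiset H × Multiset H × Multiset (H × ℝ)

/-- The argument to which the layer function is applied in order to update `h_{uv}`. -/
noncomputable def Arch.input {n : ℕ} {H : Type u} (rsub rcut : ℝ≥0∞) (P : PointCloud n)
    (h : Fin n → Fin n → H) (u v : Fin n) : (A : Arch) → A.Input H
  | .GeoIDGNN => (h u v, geoLocalU rsub rcut P h u v)
  | .GeoDSGNN => (h u v, geoLocalU rsub rcut P h u v)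
  | .GeoOSAN => (h u v, geoLocalU rsub rcut P h u v)
  | .GeoGNNAK =>
      if u = v then .inr (h v v, geoLocalU rsub rcut P h u v, globalU h u)
      else .inl (h u v, h v v, geoLocalU rsub rcut P h u v)
  | .GeoDSSGNN => (h u v, geoLocalU rsub rcut P h u v, globalV h v, geoCross rcut P h v)
  | .GeoGNNAKctx =>
      if u = v then .inr (h v v, geoLocalU rsub rcut P h u v, globalU h u, globalV h v)
      else .inl (h u v, h v v, geoLocalU rsub rcut P h u v)
  | .GeoSUN =>
      (h u v, h u u, h v v, geoLocalU rsub rcut P h u v, globalU h u, globalV h v,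
        geoCross rcut P h v)

/-- The intermediate functions of a model of architecture `A` with `L` layers. Here `H l` is the
space of node features after `l` layers, `S` is the space of subgraph features (or node
features) between the two pooling levels, and `O` is the space of graph representations.
Only the functions `layer l` with `l < L` are used. -/
structure Params (A : Arch) (L : ℕ) (H : ℕ → Type u) (S O : Type u) where
  init : Bool → H 0
  layer : ∀ l : ℕ, A.Input (H l) → H (l + 1)
  poolInner : Multiset (H L) → S
  poolOuter : Multiset S → O

namespace Params

variable {A : Arch} {L : ℕ} {H : ℕ → Type u} {S O : Type u}

/-- The feature `h^{(l)}_{uv}` of node `v` in the subgraph of `u`. Point clouds are unlabelled, so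
that the initial feature depends on the marking of the node `u` in its subgraph only. -/
noncomputable def feature (θ : Params A L H S O) (rsub rcut : ℝ≥0∞) {n : ℕ} (P : PointCloud n) :
    (l : ℕ) → Fin n → Fin n → H l
  | 0 => fun u v => θ.init (decide (u = v))
  | l + 1 => fun u v => θ.layer l (A.input rsub rcut P (feature θ rsub rcut P l) u v)

/-- The function on point clouds computed by the model. -/
noncomputable def output (θ : Params A L H S O) (rsub rcut : ℝ≥0∞) :
    Pooling → ∀ n : ℕ, PointCloud n → O
  | .VS => fun n P => θ.poolOuter ((Finset.univ : Finset (Fin n)).val.map fun u =>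
      θ.poolInner (globalU (θ.feature rsub rcut P L) u))
  | .SV => fun n P => θ.poolOuter ((Finset.univ : Finset (Fin n)).val.map fun v =>
      θ.poolInner (globalV (θ.feature rsub rcut P L) v))

/-- All intermediate functions are injective on the arguments that can occur for point clouds with
at most `N` points (for arbitrary node features `h`). This is implied by injectivity. -/
structure InjectiveUpTo (θ : Params A L H S O) (rsub rcut : ℝ≥0∞) (N : ℕ∞) : Prop where
  init : Function.Injective θ.init
  layer : ∀ l < L, Set.InjOn (θ.layer l)
    {x | ∃ (n : ℕ) (P : PointCloud n) (h : Fin n → Fin n → H l) (u v : Fin n),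
      (n : ℕ∞) ≤ N ∧ x = A.input rsub rcut P h u v}
  poolInner : Set.InjOn θ.poolInner {s | (Multiset.card s : ℕ∞) ≤ N}
  poolOuter : Set.InjOn θ.poolOuter {s | (Multiset.card s : ℕ∞) ≤ N}

end Params

end GeoSubgraph

/-! Invariance holds because, with infinite radii, every aggregation runs over all points and sees
only distances and node marks. For separation, injectivity lets equal outputs be unwound layer by
layer. Every architecture's layer argument retains the old feature and the local aggregation, so
these two suffice.

Place the barycentre at the origin. One layer determines the distance between `u` and `v` and the
distances from `v`, hence the norm of `v`. Two layers determine the cloud up to a permutation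
preserving norms and inner products with `u` and `v` (`Matches`). A third layer lets the pair `(u,
v)` be refined by every further point `w`, with its distance to `v`.

The geometric core is `exists_congruence_of_matches`. A cloud in the span of two of its vectors is
recovered from norms and inner products with these. Otherwise fix independent members U, X, and
choose Y outside their plane whose half-plane about the axis U makes the least angle with that of X.
The Gram matrix of U, X, Y is known, so an isometry aligns the two clouds on this triple. Each cloud
is then known up to reflecting individual points in span{U, X}, and likewise in span{U, Y}. By the
choice of Y, neither cloud meets the open wedge between the half-planes through X and Y. In
`exists_perm_of_wedge_empty`, an extremal point at which the two multisets differed would have to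
lie in this wedge.

Injective models exist because every layer domain over a set of cardinality continuum has at most
that cardinality. -/

namespace GeoSubgraph

open scoped RealInnerProductSpace

/-! ### Comparing multisets of values by fibre counts -/

section Counting

/-- Two families on a finite type with the same multiset of values differ by a permutation. -/
theorem exists_perm_of_card_fiber_eq {ι γ : Type*} [Fintype ι] [DecidableEq γ] {f g : ι → γ}
    (h : ∀ c, (Finset.univ.filter fun i => f i = c).card
      = (Finset.univ.filter fun i => g i = c).card) :
    ∃ σ : Equiv.Perm ι, ∀ i, g (σ i) = f i := by
  have e : ∀ c, Nonempty ({i // f i = c} ≃ {i // g i = c}) := fun c =>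
    Fintype.card_eq.1 (by simpa only [Fintype.card_subtype] using h c)
  exact ⟨Equiv.ofFiberEquiv fun c => (e c).some, fun i => Equiv.ofFiberEquiv_map _ i⟩

theorem exists_perm_of_map_univ_eq {ι γ : Type*} [Fintype ι] {f g : ι → γ}
    (h : (Finset.univ : Finset ι).val.map f = (Finset.univ : Finset ι).val.map g) :
    ∃ σ : Equiv.Perm ι, ∀ i, g (σ i) = f i := by
  classical
  refine exists_perm_of_card_fiber_eq fun c => ?_
  have := congrArg (Multiset.count c) h
  simpa only [Multiset.count_map, eq_comm (a := c), Finset.card_def, Finset.filter_val] using this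

/-- The number of indices at which `A` takes the value `a`, minus that for `B`. -/
def excess {ι E : Type*} [Fintype ι] [DecidableEq E] (A B : ι → E) (a : E) : ℤ :=
  ((Finset.univ.filter fun i => A i = a).card : ℤ) - (Finset.univ.filter fun i => B i = a).card

theorem mem_range_of_excess_ne_zero {ι E : Type*} [Fintype ι] [DecidableEq E] {A B : ι → E} {a : E}
    (h : excess A B a ≠ 0) : (∃ i, A i = a) ∨ ∃ i, B i = a := by
  by_contra! hc
  exact h (by simp [excess, hc.1, hc.2])

/-- If `A` and `B` agree up to a permutation after applying `key`, then an unbalanced value is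
accompanied by another unbalanced value with the same key. -/
theorem exists_ne_of_excess_ne_zero {ι E K : Type*} [Fintype ι] [DecidableEq E] {A B : ι → E}
    (key : E → K) (σ : Equiv.Perm ι) (hσ : ∀ i, key (B (σ i)) = key (A i)) {a : E}
    (ha : excess A B a ≠ 0) : ∃ b, b ≠ a ∧ excess A B b ≠ 0 ∧ key b = key a := by
  classical
  set S : Finset E := (Finset.univ.image A ∪ Finset.univ.image B).filter fun b => key b = key a
    with hS
  have hsum : ∀ F : ι → E, (∀ i, F i ∈ Finset.univ.image A ∪ Finset.univ.image B) →
      (Finset.univ.filter fun i => key (F i) = key a).card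
        = ∑ b ∈ S, (Finset.univ.filter fun i => F i = b).card := by
    intro F hF
    rw [Finset.card_eq_sum_card_fiberwise (f := F) (t := S)]
    · refine Finset.sum_congr rfl fun b hb => ?_
      congr 1
      ext i
      simp only [Finset.mem_filter, Finset.mem_univ, true_and, and_iff_right_iff_imp]
      rintro rfl
      exact (Finset.mem_filter.1 hb).2
    · intro i hi
      have hi' : key (F i) = key a := by simpa using hi
      exact Finset.mem_coe.2 (Finset.mem_filter.2 ⟨hF i, hi'⟩)
  have hcard : (Finset.univ.filter fun i => key (A i) = key a).card
      = (Finset.univ.filter fun i => key (B i) = key a).card :=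
    Finset.card_equiv σ fun i => by simp [hσ]
  -- The excesses cancel over each fibre of `key`, so a nonzero one cannot be alone in its fibre.
  have h0 : ∑ b ∈ S, excess A B b = 0 := by
    simp only [excess, Finset.sum_sub_distrib]
    rw [sub_eq_zero]
    have hA := hsum A fun i => by simp
    have hB := hsum B fun i => by simp
    exact_mod_cast hA.symm.trans (hcard.trans hB)
  have haS : a ∈ S := by
    rcases mem_range_of_excess_ne_zero ha with ⟨i, rfl⟩ | ⟨i, rfl⟩ <;> simp [hS]
  by_contra! hc
  refine ha ?_
  rw [← h0]
  symm
  refine Finset.sum_eq_single_of_mem a haS fun b hb hba => ?_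
  by_contra hne
  exact hc b hba hne (Finset.mem_filter.1 hb).2

end Counting

/-! ### Inner product geometry: reflections, wedges, Gram matrices -/

section Geometry

variable {E : Type*} [NormedAddCommGroup E] [InnerProductSpace ℝ E]

/-- Of two distinct vectors of equal norm, `a` lies on the positive side of the bisector. -/
theorem inner_sub_pos_of_norm_eq {a b : E} (hab : b ≠ a) (hn : ‖b‖ = ‖a‖) : 0 < ⟪a, a - b⟫ := by
  have h1 : 0 < ⟪a - b, a - b⟫ := real_inner_self_pos.2 (sub_ne_zero.2 hab.symm)
  have h2 : ⟪a, a⟫ = ⟪b, b⟫ := by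
    rw [real_inner_self_eq_norm_sq, real_inner_self_eq_norm_sq, hn]
  simp only [inner_sub_left, inner_sub_right, real_inner_comm b a] at h1 ⊢
  linarith

/-- A vector of a span is determined by its norm and its inner products with the generators. -/
theorem eq_of_mem_span_of_inner_eq {s : Set E} {a b : E} (ha : a ∈ Submodule.span ℝ s)
    (hn : ‖b‖ = ‖a‖) (hs : ∀ v ∈ s, ⟪v, b⟫ = ⟪v, a⟫) : b = a := by
  have key : ⟪a, b⟫ = ⟪a, a⟫ := by
    have : ∀ x ∈ Submodule.span ℝ s, ⟪x, b⟫ = ⟪x, a⟫ := by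
      intro x hx
      induction hx using Submodule.span_induction with
      | mem x hx => exact hs x hx
      | zero => simp
      | add x y _ _ hx hy => rw [inner_add_left, inner_add_left, hx, hy]
      | smul c x _ hx => rw [real_inner_smul_left, real_inner_smul_left, hx]
    exact this a ha
  by_contra hne
  have := inner_sub_pos_of_norm_eq hne hn
  rw [inner_sub_right, key, sub_self] at this
  exact this.false

/-- Two families that agree up to a permutation after recording norms and inner products with
`U`, `X`, and likewise with `U`, `Y`, and that have no member in the open wedge spanned by `X` and
`Y` along the axis `U`, agree up to a permutation. -/
theorem exists_perm_of_wedge_empty {ι : Type*} [Fintype ι] {A B : ι → E} {U X Y : E}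
    (hspan : Submodule.span ℝ {U, X, Y} = ⊤)
    (σ : Equiv.Perm ι) (hσ : ∀ i, ‖B (σ i)‖ = ‖A i‖ ∧ ⟪U, B (σ i)⟫ = ⟪U, A i⟫ ∧
      ⟪X, B (σ i)⟫ = ⟪X, A i⟫)
    (τ : Equiv.Perm ι) (hτ : ∀ i, ‖B (τ i)‖ = ‖A i‖ ∧ ⟪U, B (τ i)⟫ = ⟪U, A i⟫ ∧
      ⟪Y, B (τ i)⟫ = ⟪Y, A i⟫)
    (hA : ∀ i (r s t : ℝ), 0 < s → 0 < t → A i ≠ r • U + s • X + t • Y)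
    (hB : ∀ i (r s t : ℝ), 0 < s → 0 < t → B i ≠ r • U + s • X + t • Y) :
    ∃ ρ : Equiv.Perm ι, ∀ i, B (ρ i) = A i := by
  classical
  refine exists_perm_of_card_fiber_eq fun c => ?_
  by_contra hc
  set S : Finset E := (Finset.univ.image A ∪ Finset.univ.image B).filter fun b => excess A B b ≠ 0
    with hS
  have hmem : ∀ a, a ∈ S ↔ excess A B a ≠ 0 := by
    intro a
    rw [hS, Finset.mem_filter, and_iff_right_iff_imp]
    intro h
    rcases mem_range_of_excess_ne_zero h with ⟨i, rfl⟩ | ⟨i, rfl⟩ <;> simp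
  have hcS : c ∈ S := by
    rw [hmem, excess, sub_ne_zero]
    exact_mod_cast hc
  -- One functional serves both planes: a companion `b` of `a` that agrees against X is compared
  -- through Y, and conversely.
  obtain ⟨a, haS, hmax⟩ := Finset.exists_max_image S (fun b => ⟪X + Y, b⟫) ⟨c, hcS⟩
  have ha := (hmem a).1 haS
  obtain ⟨r, s, t, hrst⟩ : ∃ r s t : ℝ, r • U + s • X + t • Y = a := by
    have : a ∈ Submodule.span ℝ {U, X, Y} := hspan ▸ Submodule.mem_top
    simp only [Submodule.mem_span_insert, Submodule.mem_span_singleton] at this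
    obtain ⟨r, _, ⟨s, _, ⟨t, rfl⟩, rfl⟩, rfl⟩ := this
    exact ⟨r, s, t, by abel⟩
  have ht : 0 < t := by
    -- `b` is the mirror image of `a` in span{U, X}. Expanding the left factor of ⟪a, a - b⟫ leaves
    -- t⟪Y, a - b⟫, which is positive, while maximality gives ⟪Y, a - b⟫ ≥ 0.
    obtain ⟨b, hba, hb, hk⟩ := exists_ne_of_excess_ne_zero
      (fun v : E => (‖v‖, ⟪U, v⟫, ⟪X, v⟫)) σ (fun i => by simp [hσ i]) ha
    simp only [Prod.mk.injEq] at hk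
    have h1 := inner_sub_pos_of_norm_eq hba hk.1
    have h2 := hmax b ((hmem b).2 hb)
    rw [inner_sub_right] at h1
    nth_rewrite 1 3 [← hrst] at h1
    simp only [inner_add_left, real_inner_smul_left, hk.2] at h1 h2
    nlinarith
  have hs : 0 < s := by
    obtain ⟨b, hba, hb, hk⟩ := exists_ne_of_excess_ne_zero
      (fun v : E => (‖v‖, ⟪U, v⟫, ⟪Y, v⟫)) τ (fun i => by simp [hτ i]) ha
    simp only [Prod.mk.injEq] at hk
    have h1 := inner_sub_pos_of_norm_eq hba hk.1
    have h2 := hmax b ((hmem b).2 hb)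
    rw [inner_sub_right] at h1
    nth_rewrite 1 3 [← hrst] at h1
    simp only [inner_add_left, real_inner_smul_left, hk.2] at h1 h2
    nlinarith
  rcases mem_range_of_excess_ne_zero ha with ⟨i, hi⟩ | ⟨i, hi⟩
  · exact hA i r s t hs ht (hi.trans hrst.symm)
  · exact hB i r s t hs ht (hi.trans hrst.symm)

/-- A vector in the open cone of `e` and `f` is closer in angle to `e` than `f` is. -/
theorem inner_div_norm_lt_of_mem_cone {e f : E} (hef : |⟪e, f⟫| < ‖e‖ * ‖f‖) {s t : ℝ}
    (hs : 0 < s) (ht : 0 < t) :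
    ⟪e, f⟫ / ‖f‖ < ⟪e, s • e + t • f⟫ / ‖s • e + t • f‖ := by
  have hprod : 0 < ‖e‖ * ‖f‖ := (abs_nonneg _).trans_lt hef
  have hf : 0 < ‖f‖ := pos_of_mul_pos_right hprod (norm_nonneg e)
  have he : 0 < ‖e‖ := pos_of_mul_pos_left hprod (norm_nonneg f)
  obtain ⟨hlo, hhi⟩ := abs_lt.1 hef
  have hnorm : ‖s • e + t • f‖ ≤ s * ‖e‖ + t * ‖f‖ := by
    refine (norm_add_le _ _).trans_eq ?_
    rw [norm_smul, norm_smul, Real.norm_of_nonneg hs.le, Real.norm_of_nonneg ht.le]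
  have hcs : s * ⟪e, f⟫ + t * ‖f‖ ^ 2 ≤ ‖s • e + t • f‖ * ‖f‖ := by
    have := real_inner_le_norm (s • e + t • f) f
    rwa [inner_add_left, real_inner_smul_left, real_inner_smul_left,
      real_inner_self_eq_norm_sq] at this
  -- A vanishing combination would contradict the strict Cauchy–Schwarz inequality `hef`.
  have hpos : 0 < ‖s • e + t • f‖ := by
    rw [norm_pos_iff]
    intro h0
    have h1 : s * ‖e‖ ^ 2 + t * ⟪e, f⟫ = 0 := by
      rw [← real_inner_self_eq_norm_sq, ← real_inner_smul_right, ← real_inner_smul_right,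
        ← inner_add_right, h0, inner_zero_right]
    rw [h0, norm_zero, zero_mul] at hcs
    have hc : ⟪e, f⟫ < 0 := by nlinarith [mul_pos ht (pow_pos hf 2)]
    have h2 : s * (‖e‖ ^ 2 * ‖f‖ ^ 2 - ⟪e, f⟫ ^ 2) ≤ 0 := by
      linear_combination mul_nonneg_of_nonpos_of_nonpos hc.le hcs + ‖f‖ ^ 2 * h1
    have h3 : 0 < ‖e‖ ^ 2 * ‖f‖ ^ 2 - ⟪e, f⟫ ^ 2 := by nlinarith
    exact absurd h2 (not_le.2 (mul_pos hs h3))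
  rw [div_lt_div_iff₀ hf hpos, inner_add_right, real_inner_smul_right, real_inner_smul_right,
    real_inner_self_eq_norm_sq]
  generalize ⟪e, f⟫ = c at *
  generalize ‖s • e + t • f‖ = q at *
  -- The sign of c decides which bound on the norm q helps: the triangle inequality from above if c
  -- ≥ 0, Cauchy–Schwarz against f from below if c < 0.
  rcases le_or_gt 0 c with hc | hc
  · have h1 : c * q ≤ c * (s * ‖e‖ + t * ‖f‖) := mul_le_mul_of_nonneg_left hnorm hc
    have h2 : c * (s * ‖e‖) < ‖e‖ * ‖f‖ * (s * ‖e‖) :=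
      mul_lt_mul_of_pos_right hhi (mul_pos hs he)
    nlinarith
  · have h1 : c * (q * ‖f‖) ≤ c * (s * c + t * ‖f‖ ^ 2) :=
      mul_le_mul_of_nonpos_left hcs hc.le
    have h3 : s * c ^ 2 < s * (‖e‖ * ‖f‖) ^ 2 := mul_lt_mul_of_pos_left (by nlinarith) hs
    refine lt_of_mul_lt_mul_right (a := ‖f‖) ?_ hf.le
    nlinarith

/-- Families with the same Gram matrix are related by a linear isometry. -/
theorem exists_linearIsometryEquiv_of_inner_eq [FiniteDimensional ℝ E] {κ : Type*} {v w : κ → E}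
    (h : ∀ i j, ⟪v i, v j⟫ = ⟪w i, w j⟫) : ∃ R : E ≃ₗᵢ[ℝ] E, ∀ i, R (v i) = w i := by
  set φ := Finsupp.linearCombination ℝ v
  set ψ := Finsupp.linearCombination ℝ w
  -- Equal norms make the assignment ∑ cᵢvᵢ ↦ ∑ cᵢwᵢ well defined and isometric on the span; it then
  -- extends to the whole space.
  have hnorm : ∀ c, ‖ψ c‖ = ‖φ c‖ := by
    intro c
    have : ⟪ψ c, ψ c⟫ = ⟪φ c, φ c⟫ := by
      simp only [φ, ψ, Finsupp.linearCombination_apply, Finsupp.sum, sum_inner, inner_sum,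
        real_inner_smul_left, real_inner_smul_right, h]
    rw [real_inner_self_eq_norm_sq, real_inner_self_eq_norm_sq] at this
    exact (pow_left_inj₀ (norm_nonneg _) (norm_nonneg _) two_ne_zero).1 this
  have hker : ∀ c d, φ c = φ d → ψ c = ψ d := by
    intro c d hcd
    have := hnorm (c - d)
    rwa [map_sub, map_sub, hcd, sub_self, norm_zero, norm_eq_zero, sub_eq_zero] at this
  obtain ⟨g, hg⟩ := φ.rangeRestrict.exists_rightInverse_of_surjective φ.range_rangeRestrict
  have hg' : ∀ x : LinearMap.range φ, φ (g x) = x := fun x =>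
    congrArg Subtype.val (LinearMap.congr_fun hg x)
  let L : LinearMap.range φ →ₗᵢ[ℝ] E :=
    { toLinearMap := ψ ∘ₗ g
      norm_map' := fun x => by
        rw [LinearMap.comp_apply, hnorm, hg', Submodule.coe_norm] }
  refine ⟨L.extend.toLinearIsometryEquiv rfl, fun i => ?_⟩
  have hv : φ (Finsupp.single i 1) = v i := by simp [φ]
  have hw : ψ (Finsupp.single i 1) = w i := by simp [ψ]
  have hmem : v i ∈ LinearMap.range φ := ⟨_, hv⟩
  rw [LinearIsometry.coe_toLinearIsometryEquiv]
  have h1 := L.extend_apply ⟨v i, hmem⟩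
  rw [h1, ← hw]
  exact hker _ _ ((hg' _).trans hv.symm)

end Geometry

/-! ### Recovering a cloud from matched pairs -/

section Reconstruction

variable {E ι : Type*} [NormedAddCommGroup E] [InnerProductSpace ℝ E]

/-- The families `A` and `B` agree up to a permutation in their norms and in their inner products
with the members `u`, `v` of `A` and `u'`, `v'` of `B`, respectively. -/
def Matches (A B : ι → E) (u v u' v' : ι) : Prop :=
  ∃ σ : Equiv.Perm ι, B (σ u) = B u' ∧ B (σ v) = B v' ∧
    ∀ w, ‖B (σ w)‖ = ‖A w‖ ∧ ⟪B u', B (σ w)⟫ = ⟪A u, A w⟫ ∧ ⟪B v', B (σ w)⟫ = ⟪A v, A w⟫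

namespace Matches

variable {A B : ι → E} {u v u' v' : ι}

theorem norm_left (h : Matches A B u v u' v') : ‖B u'‖ = ‖A u‖ := by
  obtain ⟨σ, hu, -, h⟩ := h
  rw [← hu, (h u).1]

theorem norm_right (h : Matches A B u v u' v') : ‖B v'‖ = ‖A v‖ := by
  obtain ⟨σ, -, hv, h⟩ := h
  rw [← hv, (h v).1]

theorem inner_eq (h : Matches A B u v u' v') : ⟪B u', B v'⟫ = ⟪A u, A v⟫ := by
  obtain ⟨σ, -, hv, h⟩ := h
  rw [← (h v).2.1, hv]

end Matches

theorem real_inner_self_eq_of_norm_eq {a b : E} (h : ‖a‖ = ‖b‖) : ⟪a, a⟫ = ⟪b, b⟫ := by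
  rw [real_inner_self_eq_norm_sq, real_inner_self_eq_norm_sq, h]

/-- Two families agree up to an isometry if the first lies in the span of reference vectors and
the norms and the inner products with reference vectors agree. -/
theorem exists_linearIsometryEquiv_of_mem_span [FiniteDimensional ℝ E] {κ : Type*} {A B : ι → E}
    {v w : κ → E} (hvw : ∀ i j, ⟪v i, v j⟫ = ⟪w i, w j⟫) (σ : Equiv.Perm ι)
    (hσ : ∀ i, ‖B (σ i)‖ = ‖A i‖ ∧ ∀ k, ⟪w k, B (σ i)⟫ = ⟪v k, A i⟫)
    (hA : ∀ i, A i ∈ Submodule.span ℝ (Set.range v)) :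
    ∃ R : E ≃ₗᵢ[ℝ] E, ∀ i, B (σ i) = R (A i) := by
  obtain ⟨R, hR⟩ := exists_linearIsometryEquiv_of_inner_eq hvw
  refine ⟨R, fun i => ?_⟩
  rw [← R.symm_apply_eq]
  refine eq_of_mem_span_of_inner_eq (hA i) (by rw [R.symm.norm_map, (hσ i).1]) ?_
  rintro _ ⟨k, rfl⟩
  rw [← R.inner_map_map, R.apply_symm_apply, hR, (hσ i).2]

theorem span_insert_insert_eq_top (hE : Module.finrank ℝ E = 3) {U X Y : E} (hU : U ≠ 0)
    (hX : X ∉ Submodule.span ℝ {U}) (hY : Y ∉ Submodule.span ℝ {U, X}) :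
    Submodule.span ℝ {U, X, Y} = ⊤ := by
  have : FiniteDimensional ℝ E := FiniteDimensional.of_finrank_pos (by omega)
  have lt : ∀ {s t : Set E} {z : E}, s ⊆ t → z ∈ t → z ∉ Submodule.span ℝ s →
      Module.finrank ℝ (Submodule.span ℝ s) < Module.finrank ℝ (Submodule.span ℝ t) := by
    intro s t z hst hzt hzs
    exact Submodule.finrank_lt_finrank_of_lt <| (Submodule.span_mono hst).lt_of_ne fun h =>
      hzs (h ▸ Submodule.subset_span hzt)
  have h1 : Module.finrank ℝ (Submodule.span ℝ {U}) = 1 := finrank_span_singleton hU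
  have h2 := lt (t := {U, X}) (by simp) (by simp) hX
  have h3 := lt (t := {U, X, Y}) (by grind) (by simp) hY
  have h4 := (Submodule.span ℝ {U, X, Y}).finrank_le
  exact Submodule.eq_top_of_finrank_eq (by omega)

/-- The component of `a` orthogonal to `U`. -/
noncomputable def axialPart (U a : E) : E := a - (⟪U, a⟫ / ⟪U, U⟫) • U

/-- The component of `X` orthogonal to `U`, paired with the direction of that of `a`. -/
noncomputable def axialCos (U X a : E) : ℝ :=
  ⟪axialPart U X, axialPart U a⟫ / ‖axialPart U a‖

theorem inner_axialPart {U : E} (hU : U ≠ 0) (a b : E) :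
    ⟪axialPart U a, axialPart U b⟫ = ⟪a, b⟫ - ⟪U, a⟫ * ⟪U, b⟫ / ⟪U, U⟫ := by
  have : ⟪U, U⟫ ≠ 0 := inner_self_ne_zero.2 hU
  simp only [axialPart, inner_sub_left, inner_sub_right, real_inner_smul_left,
    real_inner_smul_right, real_inner_comm U a]
  field_simp
  ring

/-- The angular coordinate depends only on data that a match preserves, so extremality of Y in one
cloud passes to the other. -/
theorem axialCos_congr {U X a b : E} (hU : U ≠ 0) (hn : ‖b‖ = ‖a‖) (h1 : ⟪U, b⟫ = ⟪U, a⟫)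
    (h2 : ⟪X, b⟫ = ⟪X, a⟫) : axialCos U X b = axialCos U X a := by
  have : ‖axialPart U b‖ = ‖axialPart U a‖ := by
    rw [← pow_left_inj₀ (norm_nonneg _) (norm_nonneg _) two_ne_zero,
      ← real_inner_self_eq_norm_sq, ← real_inner_self_eq_norm_sq, inner_axialPart hU,
      inner_axialPart hU, h1, real_inner_self_eq_of_norm_eq hn]
  rw [axialCos, axialCos, this, inner_axialPart hU, inner_axialPart hU, h1, h2]

/-- Projecting out U turns the wedge into the planar open cone of the axial parts of X and Y, which
are independent; there the cone estimate applies. -/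
theorem axialCos_lt_of_mem_wedge {U X Y : E} (hU : U ≠ 0) (hX : X ∉ Submodule.span ℝ {U})
    (hY : Y ∉ Submodule.span ℝ {U, X}) {r s t : ℝ} (hs : 0 < s) (ht : 0 < t) :
    axialCos U X Y < axialCos U X (r • U + s • X + t • Y) := by
  have hUU : ⟪U, U⟫ ≠ 0 := inner_self_ne_zero.2 hU
  have hpart : axialPart U (r • U + s • X + t • Y)
      = s • axialPart U X + t • axialPart U Y := by
    simp only [axialPart, inner_add_right, real_inner_smul_right, smul_sub, smul_smul, add_div,
      add_smul, mul_div_assoc, div_self hUU, mul_one]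
    abel
  rw [axialCos, axialCos, hpart]
  refine inner_div_norm_lt_of_mem_cone ?_ hs ht
  refine (abs_real_inner_le_norm _ _).lt_of_ne fun h => ?_
  have hX0 : axialPart U X ≠ 0 := fun h0 =>
    hX (Submodule.mem_span_singleton.2 ⟨_, (sub_eq_zero.1 h0).symm⟩)
  have hY0 : axialPart U Y ≠ 0 := fun h0 =>
    hY (Submodule.span_mono (by simp)
      (Submodule.mem_span_singleton.2 ⟨_, (sub_eq_zero.1 h0).symm⟩ : Y ∈ Submodule.span ℝ {U}))
  obtain ⟨c, -, hc⟩ := (norm_inner_eq_norm_iff (𝕜 := ℝ) hX0 hY0).1 h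
  refine hY (Submodule.mem_span_pair.2 ⟨⟪U, Y⟫ / ⟪U, U⟫ - c * (⟪U, X⟫ / ⟪U, U⟫), c, ?_⟩)
  rw [axialPart, axialPart, sub_eq_iff_eq_add] at hc
  generalize ⟪U, Y⟫ / ⟪U, U⟫ = p at hc ⊢
  rw [hc]
  module

theorem notMem_span_of_mem_wedge {U X Y : E} (hY : Y ∉ Submodule.span ℝ {U, X}) {r s t : ℝ}
    (ht : 0 < t) : r • U + s • X + t • Y ∉ Submodule.span ℝ {U, X} := by
  intro h
  refine hY ?_
  have h1 : t • Y ∈ Submodule.span ℝ {U, X} := by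
    refine (Submodule.add_mem_iff_right _ ?_).1 h
    exact Submodule.mem_span_pair.2 ⟨r, s, rfl⟩
  exact (Submodule.smul_mem_iff _ ht.ne').1 h1

/-- In dimension three, a family is determined up to permutation and isometry by its matched
pairs, refined once over the second member of the pair. -/
theorem exists_congruence_of_matches [Fintype ι] [Nonempty ι] (hE : Module.finrank ℝ E = 3)
    {A B : ι → E}
    (h : ∀ u v, ∃ u' v', Matches A B u v u' v' ∧ ∃ σ : Equiv.Perm ι, ∀ w,
      Matches A B u w u' (σ w) ∧ ⟪B v', B (σ w)⟫ = ⟪A v, A w⟫) :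
    ∃ (σ : Equiv.Perm ι) (R : E ≃ₗᵢ[ℝ] E), ∀ i, B (σ i) = R (A i) := by
  classical
  have : FiniteDimensional ℝ E := FiniteDimensional.of_finrank_pos (by omega)
  by_cases hplane : ∃ u v, ∀ i, A i ∈ Submodule.span ℝ {A u, A v}
  · obtain ⟨u, v, huv⟩ := hplane
    obtain ⟨u', v', hm, -⟩ := h u v
    obtain ⟨σ, -, -, hσ⟩ := id hm
    refine ⟨σ, exists_linearIsometryEquiv_of_mem_span (v := ![A u, A v]) (w := ![B u', B v'])
      ?_ σ (fun i => ⟨(hσ i).1, ?_⟩) fun i => ?_⟩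
    · have h1 := hm.norm_left
      have h2 := hm.norm_right
      have h3 := hm.inner_eq
      have h4 : ⟪B v', B u'⟫ = ⟪A v, A u⟫ := by rw [real_inner_comm, h3, real_inner_comm]
      simp [Fin.forall_fin_two, h1, h2, h3, h4]
    · simp [Fin.forall_fin_two, hσ i]
    · simpa [Matrix.range_cons, Matrix.range_empty, Set.pair_comm] using huv i
  · push Not at hplane
    obtain ⟨i₀⟩ := ‹Nonempty ι›
    obtain ⟨u, hu⟩ := hplane i₀ i₀
    have hU : A u ≠ 0 := fun h0 => hu (h0 ▸ Submodule.zero_mem _)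
    obtain ⟨x, hx⟩ := hplane u u
    rw [Set.pair_eq_singleton] at hx
    -- Largest cosine means least unsigned angle to the half-plane of X, so mirror images in span{U,
    -- X} are not separated.
    obtain ⟨y, hyS, hmax⟩ := Finset.exists_max_image
      (Finset.univ.filter fun i => A i ∉ Submodule.span ℝ {A u, A x})
      (fun i => axialCos (A u) (A x) (A i))
      (by obtain ⟨y, hy⟩ := hplane u x; exact ⟨y, by simpa using hy⟩)
    have hy : A y ∉ Submodule.span ℝ {A u, A x} := by simpa using hyS
    replace hmax : ∀ i, A i ∉ Submodule.span ℝ {A u, A x} →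
        axialCos (A u) (A x) (A i) ≤ axialCos (A u) (A x) (A y) := fun i hi =>
      hmax i (by simpa using hi)
    obtain ⟨u', x', hux, π, hπ⟩ := h u x
    obtain ⟨huy, hxy⟩ := hπ y
    -- Only the refinement over `y` supplies ⟪A x, A y⟫; the two matches give the other entries of
    -- the Gram matrix.
    obtain ⟨R, hR⟩ : ∃ R : E ≃ₗᵢ[ℝ] E, ∀ k, R (![A u, A x, A y] k) = ![B u', B x', B (π y)] k := by
      refine exists_linearIsometryEquiv_of_inner_eq ?_
      have h1 := hux.norm_left
      have h2 := hux.norm_right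
      have h3 := huy.norm_right
      have h4 := hux.inner_eq
      have h5 := huy.inner_eq
      have h6 : ⟪B x', B u'⟫ = ⟪A x, A u⟫ := by rw [real_inner_comm, h4, real_inner_comm]
      have h7 : ⟪B (π y), B u'⟫ = ⟪A y, A u⟫ := by rw [real_inner_comm, h5, real_inner_comm]
      have h8 : ⟪B (π y), B x'⟫ = ⟪A y, A x⟫ := by rw [real_inner_comm, hxy, real_inner_comm]
      simp [Fin.forall_fin_succ, h1, h2, h3, h4, h5, h6, h7, h8, hxy]
    have hRu : R (A u) = B u' := hR 0
    have hRx : R (A x) = B x' := hR 1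
    have hRy : R (A y) = B (π y) := hR 2
    have hinner : ∀ a b, ⟪a, R.symm b⟫ = ⟪R a, b⟫ := fun a b => by
      rw [← R.inner_map_map, R.apply_symm_apply]
    obtain ⟨σ, -, -, hσ⟩ := id hux
    obtain ⟨τ, -, -, hτ⟩ := id huy
    have hσ' : ∀ i, ‖R.symm (B (σ i))‖ = ‖A i‖ ∧ ⟪A u, R.symm (B (σ i))⟫ = ⟪A u, A i⟫ ∧
        ⟪A x, R.symm (B (σ i))⟫ = ⟪A x, A i⟫ := fun i => by
      rw [R.symm.norm_map, hinner, hinner, hRu, hRx]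
      exact hσ i
    have hτ' : ∀ i, ‖R.symm (B (τ i))‖ = ‖A i‖ ∧ ⟪A u, R.symm (B (τ i))⟫ = ⟪A u, A i⟫ ∧
        ⟪A y, R.symm (B (τ i))⟫ = ⟪A y, A i⟫ := fun i => by
      rw [R.symm.norm_map, hinner, hinner, hRu, hRy]
      exact hτ i
    obtain ⟨ρ, hρ⟩ := exists_perm_of_wedge_empty (A := A) (B := fun i => R.symm (B i))
      (span_insert_insert_eq_top hE hU hx hy) σ hσ' τ hτ'
      (by
        intro i r s t hs ht hi
        have h1 := hmax i (hi ▸ notMem_span_of_mem_wedge hy ht)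
        rw [hi] at h1
        exact h1.not_gt (axialCos_lt_of_mem_wedge hU hx hy hs ht))
      (by
        intro j r s t hs ht hj
        obtain ⟨i, rfl⟩ := σ.surjective j
        -- The partner `A i` has the same angle as the aligned point of B. If `A i` lies in span{U,
        -- X}, the two coincide, yet the wedge avoids that plane; otherwise maximality of Y is
        -- violated.
        obtain ⟨k1, k2, k3⟩ := hσ' i
        have h1 := hmax i fun hmem => by
          have h2 := eq_of_mem_span_of_inner_eq hmem k1 (by simp [k2, k3])
          exact notMem_span_of_mem_wedge hy ht (hj ▸ h2 ▸ hmem)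
        rw [← axialCos_congr hU k1 k2 k3, hj] at h1
        exact h1.not_gt (axialCos_lt_of_mem_wedge hU hx hy hs ht))
    exact ⟨ρ, R, fun i => R.symm_apply_eq.1 (hρ i)⟩

/-- For a family with zero sum, the sum of squared distances to a member determines its norm. -/
theorem sum_dist_sq [Fintype ι] {A : ι → E} (hA : ∑ i, A i = 0) (v : ι) :
    ∑ w, dist (A v) (A w) ^ 2 = Fintype.card ι * ‖A v‖ ^ 2 + ∑ w, ‖A w‖ ^ 2 := by
  simp only [dist_eq_norm, norm_sub_sq_real, Finset.sum_add_distrib, Finset.sum_sub_distrib,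
    ← Finset.mul_sum, ← inner_sum, hA, inner_zero_right]
  simp

/-- Summing `sum_dist_sq` over all members gives twice the cardinality times the total squared norm.
That total therefore agrees for both families and cancels from the individual identities. -/
theorem norm_eq_of_sum_dist_sq_eq [Fintype ι] {A B : ι → E} (hA : ∑ i, A i = 0)
    (hB : ∑ i, B i = 0) (σ : Equiv.Perm ι)
    (h : ∀ w, ∑ x, dist (B (σ w)) (B x) ^ 2 = ∑ x, dist (A w) (A x) ^ 2) (w : ι) :
    ‖B (σ w)‖ = ‖A w‖ := by
  have : Nonempty ι := ⟨w⟩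
  have hcard : (0 : ℝ) < Fintype.card ι := by exact_mod_cast Fintype.card_pos
  have hsum : ∑ w, ‖B w‖ ^ 2 = ∑ w, ‖A w‖ ^ 2 := by
    have h1 : ∑ w, ∑ x, dist (B w) (B x) ^ 2 = ∑ w, ∑ x, dist (A w) (A x) ^ 2 := by
      rw [← Equiv.sum_comp σ]
      exact Finset.sum_congr rfl fun w _ => h w
    simp only [sum_dist_sq hA, sum_dist_sq hB, Finset.sum_add_distrib, ← Finset.mul_sum,
      Finset.sum_const, Finset.card_univ, nsmul_eq_mul] at h1
    nlinarith
  have h2 := h w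
  rw [sum_dist_sq hA, sum_dist_sq hB, hsum, add_left_inj] at h2
  exact (pow_left_inj₀ (norm_nonneg _) (norm_nonneg _) two_ne_zero).1
    (mul_left_cancel₀ hcard.ne' h2)

theorem inner_eq_of_norm_eq_of_dist_eq {a b c d : E} (h1 : ‖a‖ = ‖c‖) (h2 : ‖b‖ = ‖d‖)
    (h : dist a b = dist c d) : ⟪a, b⟫ = ⟪c, d⟫ := by
  have e1 := norm_sub_sq_real a b
  have e2 := norm_sub_sq_real c d
  rw [← dist_eq_norm, h, h1, h2] at e1
  rw [← dist_eq_norm] at e2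
  linarith

/-- The translate of a family with its barycentre at the origin. -/
noncomputable def centered [Fintype ι] (P : ι → E) (i : ι) : E :=
  P i - (Fintype.card ι : ℝ)⁻¹ • ∑ j, P j

theorem sum_centered [Fintype ι] (P : ι → E) : ∑ i, centered P i = 0 := by
  cases isEmpty_or_nonempty ι
  · simp
  · simp only [centered, Finset.sum_sub_distrib, Finset.sum_const, Finset.card_univ,
      ← Nat.cast_smul_eq_nsmul ℝ]
    rw [smul_inv_smul₀ (by exact_mod_cast Fintype.card_ne_zero), sub_self]

theorem dist_centered [Fintype ι] (P : ι → E) (i j : ι) :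
    dist (centered P i) (centered P j) = dist (P i) (P j) :=
  dist_sub_right _ _ _

end Reconstruction

theorem map_univ_val_comp {α β γ : Type*} [Fintype α] [Fintype β] (e : α ≃ β) (f : β → γ) :
    (Finset.univ : Finset β).val.map f = (Finset.univ : Finset α).val.map fun a => f (e a) := by
  rw [← Multiset.map_univ_val_equiv e, Multiset.map_map]
  rfl

/-! ### Layers with infinite radii -/

section Operations

variable {n m : ℕ}

@[simp]
theorem nbr_top (P : PointCloud n) (v : Fin n) : nbr ⊤ P v = Finset.univ := by
  simp [nbr, Edge]

@[simp]
theorem egoNbr_top (P : PointCloud n) (u v : Fin n) : egoNbr ⊤ ⊤ P u v = Finset.univ := by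
  simp [egoNbr, InEgo, Edge]

variable {H : Type u}

theorem Arch.input_map_equiv (A : Arch) {P : PointCloud n} {Q : PointCloud m} (σ : Fin n ≃ Fin m)
    (hd : ∀ i j, dist (Q (σ i)) (Q (σ j)) = dist (P i) (P j))
    {h : Fin n → Fin n → H} {k : Fin m → Fin m → H} (hk : ∀ i j, k (σ i) (σ j) = h i j)
    (u v : Fin n) : A.input ⊤ ⊤ Q k (σ u) (σ v) = A.input ⊤ ⊤ P h u v := by
  have hLoc : geoLocalU ⊤ ⊤ Q k (σ u) (σ v) = geoLocalU ⊤ ⊤ P h u v := by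
    simp only [geoLocalU, egoNbr_top, map_univ_val_comp σ, hd, hk]
  have hRow : ∀ w, globalU k (σ w) = globalU h w := fun w => by
    simp only [globalU, map_univ_val_comp σ, hk]
  have hCol : ∀ w, globalV k (σ w) = globalV h w := fun w => by
    simp only [globalV, map_univ_val_comp σ, hk]
  have hCr : geoCross ⊤ Q k (σ v) = geoCross ⊤ P h v := by
    simp only [geoCross, nbr_top, Finset.univ_product_univ,
      map_univ_val_comp (σ.prodCongr σ), Equiv.prodCongr_apply, Prod.map_fst, Prod.map_snd, hd, hk]
  cases A <;> simp only [Arch.input, hLoc, hRow, hCol, hCr, hk, σ.injective.eq_iff] <;> rfl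

/-- The argument of the layer function determines the old feature and the local aggregation. -/
theorem Arch.eq_of_input_eq (A : Arch) {rsub rcut : ℝ≥0∞} {P : PointCloud n} {Q : PointCloud m}
    {h : Fin n → Fin n → H} {k : Fin m → Fin m → H} {u v : Fin n} {u' v' : Fin m}
    (e : A.input rsub rcut P h u v = A.input rsub rcut Q k u' v') :
    h u v = k u' v' ∧ geoLocalU rsub rcut P h u v = geoLocalU rsub rcut Q k u' v' := by
  cases A <;> simp only [Arch.input] at e <;> grind

end Operations

/-! ### What the features determine after one, two and three layers -/

namespace Params

variable {A : Arch} {L : ℕ} {H : ℕ → Type u} {S O : Type u} (θ : Params A L H S O)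

theorem feature_map_equiv {n m : ℕ} {P : PointCloud n} {Q : PointCloud m} (σ : Fin n ≃ Fin m)
    (hd : ∀ i j, dist (Q (σ i)) (Q (σ j)) = dist (P i) (P j)) (l : ℕ) (u v : Fin n) :
    θ.feature ⊤ ⊤ Q l (σ u) (σ v) = θ.feature ⊤ ⊤ P l u v := by
  induction l generalizing u v with
  | zero => simp only [feature, σ.injective.eq_iff]
  | succ l ih => simp only [feature, A.input_map_equiv σ hd ih u v]

theorem isInvariant_output (pool : Pooling) : IsInvariant (θ.output ⊤ ⊤ pool) := by
  rintro n m P Q ⟨σ, R, t, hQ⟩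
  have hd : ∀ i j, dist (Q (σ i)) (Q (σ j)) = dist (P i) (P j) := fun i j => by
    rw [hQ, hQ, dist_add_right, R.dist_map]
  cases pool <;>
    simp only [output, globalU, globalV, map_univ_val_comp σ, θ.feature_map_equiv σ hd]

variable {θ} {rsub rcut : ℝ≥0∞} {N : ℕ∞}

/-- Equal outputs come from clouds of the same size with the same features. -/
theorem InjectiveUpTo.exists_feature_eq (hθ : θ.InjectiveUpTo rsub rcut N) {pool : Pooling}
    {n m : ℕ} (hn : (n : ℕ∞) ≤ N) (hm : (m : ℕ∞) ≤ N) {P : PointCloud n} {Q : PointCloud m}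
    (h : θ.output rsub rcut pool n P = θ.output rsub rcut pool m Q) :
    n = m ∧ ∀ u v, ∃ u' v', θ.feature rsub rcut Q L u' v' = θ.feature rsub rcut P L u v := by
  cases pool with
  | VS =>
    have h1 := hθ.poolOuter (by simpa using hn) (by simpa using hm) h
    have hnm : n = m := by simpa using congrArg Multiset.card h1
    subst hnm
    obtain ⟨σ, hσ⟩ := exists_perm_of_map_univ_eq h1
    refine ⟨rfl, fun u v => ?_⟩
    obtain ⟨τ, hτ⟩ := exists_perm_of_map_univ_eq
      (hθ.poolInner (by simpa [globalU] using hn) (by simpa [globalU] using hn) (hσ u)).symm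
    exact ⟨σ u, τ v, hτ v⟩
  | SV =>
    have h1 := hθ.poolOuter (by simpa using hn) (by simpa using hm) h
    have hnm : n = m := by simpa using congrArg Multiset.card h1
    subst hnm
    obtain ⟨σ, hσ⟩ := exists_perm_of_map_univ_eq h1
    refine ⟨rfl, fun u v => ?_⟩
    obtain ⟨τ, hτ⟩ := exists_perm_of_map_univ_eq
      (hθ.poolInner (by simpa [globalV] using hn) (by simpa [globalV] using hn) (hσ v)).symm
    exact ⟨τ u, σ v, hτ u⟩

variable {n : ℕ} {P Q : PointCloud n} {u v u' v' : Fin n}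

theorem InjectiveUpTo.of_feature_succ_eq (hθ : θ.InjectiveUpTo ⊤ ⊤ N) (hn : (n : ℕ∞) ≤ N) {l : ℕ}
    (hl : l < L) (h : θ.feature ⊤ ⊤ Q (l + 1) u' v' = θ.feature ⊤ ⊤ P (l + 1) u v) :
    θ.feature ⊤ ⊤ Q l u' v' = θ.feature ⊤ ⊤ P l u v ∧ ∃ σ : Equiv.Perm (Fin n), ∀ w,
      θ.feature ⊤ ⊤ Q l u' (σ w) = θ.feature ⊤ ⊤ P l u w ∧
        dist (Q v') (Q (σ w)) = dist (P v) (P w) := by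
  obtain ⟨h1, h2⟩ := A.eq_of_input_eq
    (hθ.layer l hl ⟨n, Q, _, u', v', hn, rfl⟩ ⟨n, P, _, u, v, hn, rfl⟩ h)
  refine ⟨h1, ?_⟩
  simp only [geoLocalU, egoNbr_top] at h2
  obtain ⟨σ, hσ⟩ := exists_perm_of_map_univ_eq h2.symm
  exact ⟨σ, fun w => Prod.mk.inj (hσ w)⟩

theorem InjectiveUpTo.of_feature_eq (hθ : θ.InjectiveUpTo ⊤ ⊤ N) (hn : (n : ℕ∞) ≤ N) {l k : ℕ}
    (hlk : l ≤ k) (hk : k ≤ L) (h : θ.feature ⊤ ⊤ Q k u' v' = θ.feature ⊤ ⊤ P k u v) :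
    θ.feature ⊤ ⊤ Q l u' v' = θ.feature ⊤ ⊤ P l u v := by
  induction k, hlk using Nat.le_induction with
  | base => exact h
  | succ k _ ih => exact ih (by omega) (hθ.of_feature_succ_eq hn (by omega) h).1

/-- After one layer, features see the distance between the two nodes and the distances from the
second node. -/
theorem InjectiveUpTo.dist_eq_of_feature_one_eq (hθ : θ.InjectiveUpTo ⊤ ⊤ N) (hn : (n : ℕ∞) ≤ N)
    (hL : 1 ≤ L) (h : θ.feature ⊤ ⊤ Q 1 u' v' = θ.feature ⊤ ⊤ P 1 u v) :
    dist (Q u') (Q v') = dist (P u) (P v) ∧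
      ∑ w, dist (Q v') (Q w) ^ 2 = ∑ w, dist (P v) (P w) ^ 2 := by
  obtain ⟨-, σ, hσ⟩ := hθ.of_feature_succ_eq hn hL h
  -- The initial feature marks exactly one node of each subgraph, and σ preserves marks.
  have hu : u' = σ u := by
    have := hθ.init (hσ u).1
    simpa using this
  refine ⟨?_, ?_⟩
  · rw [dist_comm, hu, (hσ u).2, dist_comm]
  · rw [← Equiv.sum_comp σ]
    exact Finset.sum_congr rfl fun w _ => by rw [(hσ w).2]

/-- The permutation from the second layer respects first-layer features, which supply norms about
the barycentre and distances to `u`; the aggregation itself records distances to `v`. Polarization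
turns these into inner products. -/
theorem InjectiveUpTo.matches_of_feature_two_eq (hθ : θ.InjectiveUpTo ⊤ ⊤ N) (hn : (n : ℕ∞) ≤ N)
    (hL : 2 ≤ L) (h : θ.feature ⊤ ⊤ Q 2 u' v' = θ.feature ⊤ ⊤ P 2 u v) :
    Matches (centered P) (centered Q) u v u' v' := by
  obtain ⟨-, σ, hσ⟩ := hθ.of_feature_succ_eq hn hL h
  have h1 := fun w => hθ.dist_eq_of_feature_one_eq hn (by omega) (hσ w).1
  have hnorm : ∀ w, ‖centered Q (σ w)‖ = ‖centered P w‖ :=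
    norm_eq_of_sum_dist_sq_eq (sum_centered P) (sum_centered Q) σ fun w => by
      simpa only [dist_centered] using (h1 w).2
  -- Points may repeat, so distance zero identifies positions rather than indices.
  have hu : centered Q (σ u) = centered Q u' := by
    rw [eq_comm, ← dist_eq_zero, dist_centered, (h1 u).1, dist_self]
  have hv : centered Q (σ v) = centered Q v' := by
    rw [eq_comm, ← dist_eq_zero, dist_centered, (hσ v).2, dist_self]
  refine ⟨σ, hu, hv, fun w => ⟨hnorm w, ?_, ?_⟩⟩
  · refine inner_eq_of_norm_eq_of_dist_eq (by rw [← hu, hnorm]) (hnorm w) ?_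
    rw [dist_centered, dist_centered, (h1 w).1]
  · refine inner_eq_of_norm_eq_of_dist_eq (by rw [← hv, hnorm]) (hnorm w) ?_
    rw [dist_centered, dist_centered, (hσ w).2]

theorem InjectiveUpTo.e3CompleteUpTo (hθ : θ.InjectiveUpTo ⊤ ⊤ N) (hL : 3 ≤ L) (pool : Pooling) :
    E3CompleteUpTo N (θ.output ⊤ ⊤ pool) := by
  refine ⟨θ.isInvariant_output pool, fun n m hn0 _ hn hm P Q hPQ heq => hPQ ?_⟩
  obtain ⟨rfl, hfeat⟩ := hθ.exists_feature_eq hn hm heq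
  have : Nonempty (Fin n) := ⟨⟨0, hn0⟩⟩
  obtain ⟨σ, R, hR⟩ := exists_congruence_of_matches (E := Point) (by simp)
    (A := centered P) (B := centered Q) fun u v => by
      obtain ⟨u', v', h⟩ := hfeat u v
      have h3 := hθ.of_feature_eq hn hL le_rfl h
      obtain ⟨h2, σ, hσ⟩ := hθ.of_feature_succ_eq hn (by omega) h3
      have huv := hθ.matches_of_feature_two_eq hn (by omega) h2
      refine ⟨u', v', huv, σ, fun w => ?_⟩
      have huw := hθ.matches_of_feature_two_eq hn (by omega) (hσ w).1
      refine ⟨huw, inner_eq_of_norm_eq_of_dist_eq huv.norm_right huw.norm_right ?_⟩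
      rw [dist_centered, dist_centered, (hσ w).2]
  -- The translation carries the image under R of the barycentre of P to the barycentre of Q.
  refine ⟨σ, R, (Fintype.card (Fin n) : ℝ)⁻¹ • ∑ j, Q j
    - R ((Fintype.card (Fin n) : ℝ)⁻¹ • ∑ j, P j), fun i => ?_⟩
  have h := hR i
  rw [centered, centered, map_sub, sub_eq_iff_eq_add] at h
  rw [h]
  abel

end Params

/-! ### Existence of injective intermediate functions -/

section Cardinality

open Cardinal

theorem mk_prod_le_continuum {α β : Type} (hα : #α ≤ 𝔠) (hβ : #β ≤ 𝔠) : #(α × β) ≤ 𝔠 := by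
  rw [← mul_def, ← continuum_mul_self]
  exact mul_le_mul' hα hβ

theorem mk_sum_le_continuum {α β : Type} (hα : #α ≤ 𝔠) (hβ : #β ≤ 𝔠) : #(α ⊕ β) ≤ 𝔠 := by
  rw [← add_def, ← continuum_add_self]
  exact add_le_add hα hβ

theorem mk_multiset_le_continuum {α : Type} (hα : #α ≤ 𝔠) : #(Multiset α) ≤ 𝔠 :=
  (mk_le_of_surjective (f := ((↑) : List α → Multiset α)) Quot.mk_surjective).trans <|
    (mk_list_le_max α).trans (max_le aleph0_le_continuum hα)

theorem Arch.mk_input_le_continuum (A : Arch) {H : Type} (hH : #H ≤ 𝔠) : #(A.Input H) ≤ 𝔠 := by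
  have h1 := mk_multiset_le_continuum hH
  have h2 := mk_multiset_le_continuum (mk_prod_le_continuum hH mk_real.le)
  cases A <;> simp only [Arch.Input] <;>
    repeat' first
      | assumption
      | apply mk_prod_le_continuum
      | apply mk_sum_le_continuum

theorem exists_params_injectiveUpTo (A : Arch) (L : ℕ) {H : Type} (hH : #H = 𝔠)
    (rsub rcut : ℝ≥0∞) :
    ∃ θ : Params A L (fun _ => H) H H, θ.InjectiveUpTo rsub rcut ⊤ := by
  have emb : ∀ {α : Type}, #α ≤ 𝔠 → Nonempty (α ↪ H) := fun h =>
    Cardinal.le_def _ _ |>.1 (h.trans hH.ge)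
  obtain ⟨f⟩ := emb (α := Bool) ((lt_aleph0_of_finite Bool).le.trans aleph0_le_continuum)
  obtain ⟨g⟩ := emb (A.mk_input_le_continuum hH.le)
  obtain ⟨p⟩ := emb (mk_multiset_le_continuum hH.le)
  exact ⟨⟨f, fun _ => g, p, p⟩, f.injective, fun _ _ => g.injective.injOn, p.injective.injOn,
    p.injective.injOn⟩

theorem mk_euclideanSpace_fin {k : ℕ} (hk : 1 ≤ k) : #(EuclideanSpace ℝ (Fin k)) = 𝔠 := by
  rw [mk_congr (EuclideanSpace.equiv (Fin k) ℝ).toEquiv, mk_pi, prod_const, mk_fin, mk_real]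
  simpa using power_nat_eq aleph0_le_continuum hk

end Cardinality

end GeoSubgraph

theorem mainTheorem6 :
    ∃ C : ℕ, ∀ (A : GeoSubgraph.Arch) (pool : GeoSubgraph.Pooling), A.AllowsPooling pool →
      ∀ L : ℕ, C < L → ∀ rsub rcut : ENNReal, rsub = ⊤ → rcut = ⊤ →
        (∀ (H : ℕ → Type u) (S O : Type u) (θ : GeoSubgraph.Params A L H S O) (N : ℕ∞),
          θ.InjectiveUpTo rsub rcut N →
            GeoSubgraph.E3CompleteUpTo N (θ.output rsub rcut pool)) ∧
        (∀ k : ℕ, 1 ≤ k →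
          ∃ θ : GeoSubgraph.Params A L (fun _ => EuclideanSpace ℝ (Fin k))
              (EuclideanSpace ℝ (Fin k)) (EuclideanSpace ℝ (Fin k)),
            θ.InjectiveUpTo rsub rcut ⊤ ∧
              GeoSubgraph.E3Complete (θ.output rsub rcut pool)) := by
  -- L > 2 provides the three layers used: one for norms and distances, one for matches, one for
  -- their refinement.
  refine ⟨2, fun A pool _ L hL rsub rcut hsub hcut => ?_⟩
  subst hsub hcut
  refine ⟨fun H S O θ N hθ => hθ.e3CompleteUpTo hL pool, fun k hk => ?_⟩
  obtain ⟨θ, hθ⟩ := GeoSubgraph.exists_params_injectiveUpTo A L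
    (GeoSubgraph.mk_euclideanSpace_fin hk) ⊤ ⊤
  exact ⟨θ, hθ, hθ.e3CompleteUpTo hL pool⟩
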